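/- For probability measures $\mu,\nu$ on measurable spaces, let $\Gamma(\mu,\nu)$ be the set of probability measures on the product space with marginals $\mu$ and $\nu$. Let $p(x,y)$ and $q(x,y)$ be two probability distributions on $\mathcal X\times\mathcal Y$, where $\mathcal X=\mathbb R^m$ and $\mathcal Y=\mathbb R^n$, factorized as $p(x,y)=p(y)\,p(x|y)$ and $q(x,y)=q(y)\,q(x|y)$ into the marginal distribution of $y$ and (any version of) the regular conditional distribution of $x$ given $y$. Let $1\le s\le\infty$, let $\|\cdot\|_s$ be the $\ell^s$ norm on $\mathbb R^{m+n}$, and put $$D\big(p(x|y),q(x|z)\big)=\inf_{r'\in\Gamma(p(x|y),\,q(x'|z))}E_{r'(x,x')}\|(x,y)-(x',z)\|_s .$$ Define the chain rule optimal transport (CROT) distance $$H_D(p,q)=\inf_{r\in\Gamma(p(y),\,q(z))}E_{r(y,z)}\Big[D\big(p(x|y),q(x|z)\big)\Big].$$ All expectations take values in $[0,\infty]$. Then $$H_D(p,q)\;\ge\;\inf_{r\in\Gamma(p(x,y),\,q(x',z))}E_{r}\,\|(x,y)-(x',z)\|_s .$$ More generally, let $\mathcal X,\mathcal Y$ be arbitrary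 standard Borel spaces and let $d$ be any metric on $\mathcal X\times\mathcal Y$ that is jointly measurable as a function on $(\mathcal X\times\mathcal Y)^2$. Then the same inequality holds with $\|(x,y)-(x',z)\|_s$ replaced by $d\big((x,y),(x',z)\big)$ both in the definition of $D$ and on the right-hand side. -/

import Mathlib

open MeasureTheory ProbabilityTheory
open scoped ENNReal

noncomputable section

namespace CROT

/-- `Γ(μ, ν)`: the probability measures on `α × β` with marginals `μ` and `ν`. -/
def couplings {α β : Type*} [MeasurableSpace α] [MeasurableSpace β]
    (μ : Measure α) (ν : Measure β) : Set (Measure (α × β)) :=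
  {r | IsProbabilityMeasure r ∧ r.fst = μ ∧ r.snd = ν}

/-- The optimal transport cost `inf_{r ∈ Γ(μ, ν)} E_r [c]`, with values in `[0, ∞]`. -/
def otCost {α β : Type*} [MeasurableSpace α] [MeasurableSpace β]
    (c : α → β → ℝ≥0∞) (μ : Measure α) (ν : Measure β) : ℝ≥0∞ :=
  ⨅ r ∈ couplings μ ν, ∫⁻ w, c w.1 w.2 ∂r

/-- `P` is a version of the conditional distribution `p(x|y)` of the joint distribution `p(x,y)`,
that is, `p(x,y) = p(y) p(x|y)`. Mathlib's `IsCondKernel` conditions on the first coordinate,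
whence the swap. -/
def IsConditional {X Y : Type*} [MeasurableSpace X] [MeasurableSpace Y]
    (p : Measure (X × Y)) (P : Kernel Y X) : Prop :=
  (p.map Prod.swap).IsCondKernel P

/-- The chain rule optimal transport `H_D(p, q) = inf_{r ∈ Γ(p(y), q(z))} E_{r(y,z)} D(p(x|y), q(x|z))`
of two joint distributions with conditionals `P = p(x|y)` and `Q = q(x|z)`. The ground distance `D`
may look at the label `y` of the conditional `p(x|y)` as well as at the measure itself.
If the integrand is not measurable, `∫⁻` is the lower integral. -/
def crot {X Y : Type*} [MeasurableSpace X] [MeasurableSpace Y]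
    (D : Y × Measure X → Y × Measure X → ℝ≥0∞)
    (p q : Measure (X × Y)) (P Q : Kernel Y X) : ℝ≥0∞ :=
  ⨅ r ∈ couplings p.snd q.snd, ∫⁻ w, D (w.1, P w.1) (w.2, Q w.2) ∂r

/-- The ground distance
`D(p(x|y), q(x|z)) = inf_{r' ∈ Γ(p(x|y), q(x'|z))} E_{r'(x,x')} c((x,y), (x',z))`. -/
def otGround {X Y : Type*} [MeasurableSpace X]
    (c : X × Y → X × Y → ℝ≥0∞) : Y × Measure X → Y × Measure X → ℝ≥0∞ :=
  fun a b => otCost (fun x x' => c (x, a.1) (x', b.1)) a.2 b.2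

/-- `‖(x,y) - (x',z)‖_s` for `(x,y), (x',z) ∈ ℝ^m × ℝ^n = ℝ^(m+n)`. -/
def pNormCost (m n : ℕ) (s : ℝ≥0∞) (a b : (Fin m → ℝ) × (Fin n → ℝ)) : ℝ≥0∞ :=
  ENNReal.ofReal
    ‖(WithLp.toLp s (Sum.elim (a.1 - b.1) (a.2 - b.2)) : PiLp s fun _ : Fin m ⊕ Fin n => ℝ)‖

/-- The cost `d(a, b)` of a metric `d` on `α`. -/
def metricCost {α : Type*} (d : MetricSpace α) (a b : α) : ℝ≥0∞ :=
  ENNReal.ofReal (d.dist a b)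

end CROT

end

namespace CROT

open Set Filter Topology

/-! Fix a coupling `r` of the `Y`-marginals. If an `ε`-optimal coupling of `P y` and `Q z` is chosen
measurably in `(y, z)`, integrating it against `r` gives a coupling of `p` and `q` with cost at most
`E_r D + ε`. Everything rests on this choice, which is only needed `r`-almost everywhere. Couplings
are parametrized by CDFs on `ℚ` (`exists_markovKernel_forall_exists_eq`), so that admissibility and
cost become Borel. Sublevel sets of the cost are then uniformized
(`exists_measurable_ae_uniformization`): the projection of a Borel set is a continuous image of the
Baire space, exhausted up to a null set by images of compact sets, and over a compact set each
nonempty fibre has a point minimizing an injective real function. -/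

/-! ### Measurable uniformization almost everywhere -/

/-- A sequence bounded by `N` in its first `k` coordinates eventually lies in a given
neighbourhood of the compact box of all sequences bounded by `N`. -/
lemma exists_forall_lt_le_subset_of_isOpen {N : ℕ → ℕ} {O : Set (ℕ → ℕ)} (hO : IsOpen O)
    (hNO : Set.pi univ (fun i => Iic (N i)) ⊆ O) :
    ∃ k, {a : ℕ → ℕ | ∀ i < k, a i ≤ N i} ⊆ O := by
  by_contra! h
  simp only [not_subset] at h
  choose a ha haO using h
  have hK : IsCompact (Set.pi univ (fun i => Iic (N i)) : Set (ℕ → ℕ)) :=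
    isCompact_univ_pi fun i => (finite_Iic (N i)).isCompact
  -- Truncation at `N` puts the sequence in the box, and leaves coordinate `i` unchanged once `k >
  -- i`.
  obtain ⟨b, hb, φ, hφ, hlim⟩ := hK.tendsto_subseq
    (x := fun k i => min (a k i) (N i)) (fun k i _ => mem_Iic.2 (min_le_right _ _))
  have hlim' : Tendsto (a ∘ φ) atTop (𝓝 b) := by
    rw [tendsto_pi_nhds] at hlim ⊢
    intro i
    refine (hlim i).congr' ?_
    filter_upwards [eventually_gt_atTop i] with k hk
    exact min_eq_left (ha (φ k) i (hk.trans_le (hφ.id_le k)))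
  have hbO : b ∈ Oᶜ :=
    hO.isClosed_compl.mem_of_tendsto hlim' (Eventually.of_forall fun k => haO (φ k))
  exact hbO (hNO hb)

/-- Inner regularity of finite measures on continuous images of the Baire space: such an image is
approximated in measure from inside by images of compact sets. -/
theorem exists_isCompact_le_measure_image {W : Type*} [TopologicalSpace W] [T2Space W]
    [MeasurableSpace W] [OpensMeasurableSpace W] (r : Measure W) [IsFiniteMeasure r]
    {g : (ℕ → ℕ) → W} (hg : Continuous g) {c : ℝ≥0∞} (hc : c < r (range g)) :
    ∃ K, IsCompact K ∧ c ≤ r (g '' K) := by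
  have step : ∀ (k : ℕ) (A : {A : Set (ℕ → ℕ) // c < r (g '' A)}),
      ∃ m, c < r (g '' (A.1 ∩ {a | a k ≤ m})) := by
    intro k A
    have hmono : Monotone fun m => g '' (A.1 ∩ {a | a k ≤ m}) := fun m n hmn =>
      image_mono (inter_subset_inter_right _ fun a (ha : a k ≤ m) => ha.trans hmn)
    have hun : ⋃ m, g '' (A.1 ∩ {a | a k ≤ m}) = g '' A.1 := by
      rw [← image_iUnion, ← inter_iUnion]
      congr 1
      refine inter_eq_left.2 fun a _ => mem_iUnion.2 ⟨a k, le_refl (a k)⟩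
    have := A.2
    -- Continuity from below needs no measurability, and these images are merely analytic.
    rw [← hun, hmono.measure_iUnion] at this
    exact lt_iSup_iff.1 this
  choose m hm using step
  let S : ℕ → {A : Set (ℕ → ℕ) // c < r (g '' A)} := fun k =>
    Nat.rec ⟨univ, by rwa [image_univ]⟩ (fun k A => ⟨A.1 ∩ {a | a k ≤ m k A}, hm k A⟩) k
  let N : ℕ → ℕ := fun k => m k (S k)
  have hS : ∀ k, (S k).1 = {a | ∀ i < k, a i ≤ N i} := by
    intro k
    induction k with
    | zero => ext a; simp [S]
    | succ k ih =>
      change (S k).1 ∩ {a | a k ≤ N k} = _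
      rw [ih]
      ext a
      exact Nat.forall_lt_succ_right.symm
  let K : Set (ℕ → ℕ) := Set.pi univ fun i => Iic (N i)
  have hK : IsCompact K := isCompact_univ_pi fun i => (finite_Iic (N i)).isCompact
  refine ⟨K, hK, ?_⟩
  -- Closures make the sets measurable, as continuity from above requires; compactness of `K` makes
  -- them harmless.
  have hsub : ⋂ k, closure (g '' (S k).1) ⊆ g '' K := by
    intro w hw
    by_contra hwK
    obtain ⟨U, V, hU, hV, hKU, hwV, hUV⟩ :=
      SeparatedNhds.of_isCompact_isCompact (hK.image hg) isCompact_singleton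
        (disjoint_singleton_right.2 hwK)
    obtain ⟨k, hk⟩ := exists_forall_lt_le_subset_of_isOpen (hU.preimage hg)
      (image_subset_iff.1 hKU)
    rw [← hS k, ← image_subset_iff] at hk
    obtain ⟨x, hxV, hxS⟩ := mem_closure_iff.1 (mem_iInter.1 hw k) V hV (hwV rfl)
    exact hUV.le_bot ⟨hk hxS, hxV⟩
  refine le_trans ?_ (measure_mono hsub)
  have hanti : Antitone fun k => closure (g '' (S k).1) := by
    refine antitone_nat_of_succ_le fun k => closure_mono (image_mono ?_)
    exact inter_subset_left
  rw [hanti.measure_iInter (fun k => isClosed_closure.measurableSet.nullMeasurableSet)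
    ⟨0, measure_ne_top _ _⟩]
  exact le_iInf fun k => (S k).2.le.trans (measure_mono subset_closure)

/-- The Baire space injects continuously into the real line. -/
lemma exists_continuous_injective_real :
    ∃ φ : (ℕ → ℕ) → ℝ, Continuous φ ∧ Function.Injective φ := by
  -- Each bit records whether `a i ≤ j`, so it depends on one coordinate, and all bits together
  -- determine `a`.
  let e : (ℕ → ℕ) → (ℕ → Bool) := fun a n => decide (a n.unpair.1 ≤ n.unpair.2)
  have he : Continuous e := continuous_pi fun n =>
    (continuous_of_discreteTopology (f := fun j : ℕ => decide (j ≤ n.unpair.2))).comp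
      (continuous_apply _)
  have hinj : Function.Injective e := by
    intro a b hab
    have key : ∀ i j, a i ≤ j ↔ b i ≤ j := fun i j => by
      have := congrFun hab (Nat.pair i j)
      simpa [e] using this
    funext i
    exact le_antisymm ((key i _).2 le_rfl) ((key i _).1 le_rfl)
  exact ⟨fun a => (cantorSetHomeomorphNatToBool.symm (e a) : ℝ),
    continuous_subtype_val.comp (cantorSetHomeomorphNatToBool.symm.continuous.comp he),
    Subtype.val_injective.comp (cantorSetHomeomorphNatToBool.symm.injective.comp hinj)⟩

/-- A continuous map on a compact subset of the Baire space has a measurable section. -/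
lemma exists_measurable_section_of_isCompact {W : Type*} [TopologicalSpace W] [T2Space W]
    [MeasurableSpace W] [OpensMeasurableSpace W] {g : (ℕ → ℕ) → W} (hg : Continuous g)
    {K : Set (ℕ → ℕ)} (hK : IsCompact K) :
    ∃ σ : W → ℕ → ℕ, Measurable σ ∧ ∀ w ∈ g '' K, g (σ w) = w := by
  obtain ⟨φ, hφ, hinj⟩ := exists_continuous_injective_real
  obtain ⟨ψ, hψ, hψφ⟩ := (hφ.measurableEmbedding hinj).exists_measurable_extend
    measurable_id (fun _ => ⟨fun _ => 0⟩)
  let fiber : W → Set (ℕ → ℕ) := fun w => K ∩ g ⁻¹' {w}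
  have hfib : ∀ w, IsCompact (φ '' fiber w) := fun w =>
    (hK.inter_right (isClosed_singleton.preimage hg)).image hφ
  let m : W → ℝ := fun w => sInf (φ '' fiber w)
  have hmem : ∀ w ∈ g '' K, m w ∈ φ '' fiber w := by
    rintro w ⟨a, ha, rfl⟩
    exact (hfib _).sInf_mem ⟨φ a, a, ⟨ha, rfl⟩, rfl⟩
  have hgK : ∀ {L : Set (ℕ → ℕ)}, IsCompact L → MeasurableSet (g '' L) := fun hL =>
    (hL.image hg).isClosed.measurableSet
  have hm : Measurable m := by
    refine measurable_of_Iic fun t => ?_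
    -- The second piece reflects `sInf ∅ = 0` off the image of `K`.
    have : m ⁻¹' Iic t = g '' (K ∩ φ ⁻¹' Iic t) ∪ ((g '' K)ᶜ ∩ {_w | (0 : ℝ) ≤ t}) := by
      ext w
      by_cases hw : w ∈ g '' K
      · simp only [mem_preimage, mem_Iic, mem_union, mem_inter_iff, mem_compl_iff, hw,
          not_true_eq_false, false_and, or_false]
        constructor
        · intro h
          obtain ⟨a, ⟨haK, haw⟩, ha⟩ := hmem w hw
          exact ⟨a, ⟨haK, show φ a ≤ t from ha.trans_le h⟩, haw⟩
        · rintro ⟨a, ⟨haK, hat⟩, haw⟩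
          exact (csInf_le (hfib w).bddBelow ⟨a, ⟨haK, haw⟩, rfl⟩).trans hat
      · have hm0 : m w = 0 := by
          have : fiber w = ∅ := eq_empty_of_forall_notMem fun a ha => hw ⟨a, ha.1, ha.2⟩
          simp [m, this]
        have hw' : w ∉ g '' (K ∩ φ ⁻¹' Iic t) := fun h => hw (image_mono inter_subset_left h)
        simp only [mem_preimage, mem_Iic, mem_union, mem_inter_iff, mem_compl_iff, hw, hw', hm0]
        simp
    rw [this]
    exact (hgK (hK.inter_right (isClosed_Iic.preimage hφ))).union
      ((hgK hK).compl.inter (MeasurableSet.const _))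
  refine ⟨ψ ∘ m, hψ.comp hm, fun w hw => ?_⟩
  obtain ⟨a, ha, haw⟩ := hmem w hw
  have : ψ (m w) = a := by rw [← haw]; exact congrFun hψφ a
  rw [Function.comp_apply, this]
  exact ha.2

/-- Patching a sequence of measurable functions along a sequence of measurable sets. -/
lemma exists_measurable_patch {W M : Type*} [MeasurableSpace W] [MeasurableSpace M]
    {s : ℕ → W → M} (hs : ∀ n, Measurable (s n)) {p : ℕ → Set W} (hp : ∀ n, MeasurableSet (p n))
    {d : W → M} (hd : Measurable d) :
    ∃ s' : W → M, Measurable s' ∧ ∀ w, (∀ n, w ∈ p n → ∃ k ≤ n, w ∈ p k ∧ s' w = s k w) ∧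
      ((∀ n, w ∉ p n) → s' w = d w) := by
  classical
  have hU : MeasurableSet (⋃ n, p n) := .iUnion hp
  -- The second alternative only makes `Nat.find` total.
  have hex : ∀ w, ∃ n, w ∈ p n ∨ w ∉ ⋃ k, p k := fun w => by
    by_cases h : w ∈ ⋃ k, p k
    · exact (mem_iUnion.1 h).imp fun n hn => Or.inl hn
    · exact ⟨0, Or.inr h⟩
  refine ⟨fun w => (if w ∈ ⋃ k, p k then s (Nat.find (hex w)) w else d w),
    Measurable.ite hU (Measurable.find (p := fun n w => w ∈ p n ∨ w ∉ ⋃ k, p k) hs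
      (fun n => (hp n).union hU.compl) hex) hd,
    fun w => ⟨fun n hn => ?_, fun h => ?_⟩⟩
  · have hw : w ∈ ⋃ k, p k := mem_iUnion.2 ⟨n, hn⟩
    refine ⟨Nat.find (hex w), Nat.find_min' (hex w) (Or.inl hn), ?_, by simp only [if_pos hw]⟩
    exact (Nat.find_spec (hex w)).resolve_right (fun h => h hw)
  · exact if_neg (by simpa using h)

/-- A measurable subset of a product of standard Borel spaces admits a measurable uniformization
over almost every point of its projection. -/
theorem exists_measurable_ae_uniformization {W M : Type*} [MeasurableSpace W]
    [StandardBorelSpace W] [MeasurableSpace M] [StandardBorelSpace M] [Nonempty M]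
    (r : Measure W) [IsFiniteMeasure r] {B : Set (W × M)} (hB : MeasurableSet B) :
    ∃ s : W → M, Measurable s ∧ ∀ᵐ w ∂r, (∃ F, (w, F) ∈ B) → (w, s w) ∈ B := by
  inhabit M
  let := upgradeStandardBorel W
  let := upgradeStandardBorel M
  have hBa : AnalyticSet B := hB.analyticSet
  rw [AnalyticSet] at hBa
  rcases hBa with rfl | ⟨f, hf, rfl⟩
  · exact ⟨fun _ => default, measurable_const, by simp⟩
  let g : (ℕ → ℕ) → W := fun a => (f a).1
  have hg : Continuous g := continuous_fst.comp hf
  by_cases h0 : r (range g) = 0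
  · refine ⟨fun _ => default, measurable_const, ?_⟩
    filter_upwards [measure_eq_zero_iff_ae_notMem.1 h0] with w hw
    rintro ⟨F, a, ha⟩
    exact absurd ⟨a, congrArg Prod.fst ha⟩ hw
  have hlt : ∀ n : ℕ, r (range g) - ((n : ℝ≥0∞) + 1)⁻¹ < r (range g) := fun n =>
    ENNReal.sub_lt_self (measure_ne_top _ _) h0 (by simp [ENNReal.inv_eq_zero])
  choose K hK hKr using fun n => exists_isCompact_le_measure_image r hg (hlt n)
  choose σ hσ hσg using fun n => exists_measurable_section_of_isCompact hg (hK n)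
  -- The `n`th section is used wherever it lands in the Borel set, which includes all of `g '' K n`.
  obtain ⟨s, hs, hsp⟩ := exists_measurable_patch (s := fun n w => (f (σ n w)).2)
    (p := fun n => {w | (w, (f (σ n w)).2) ∈ range f})
    (fun n => measurable_snd.comp (hf.measurable.comp (hσ n)))
    (fun n => (measurable_id.prodMk (measurable_snd.comp (hf.measurable.comp (hσ n)))) hB)
    (measurable_const (a := (default : M)))
  refine ⟨s, hs, ?_⟩
  have hA : MeasurableSet (⋃ n, g '' K n) :=
    .iUnion fun n => ((hK n).image hg).isClosed.measurableSet
  have hAsub : (⋃ n, g '' K n) ⊆ range g := iUnion_subset fun n => image_subset_range _ _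
  have hle : r (range g) ≤ r (⋃ n, g '' K n) := by
    have hlim : Tendsto (fun n : ℕ => r (⋃ n, g '' K n) + ((n : ℝ≥0∞) + 1)⁻¹) atTop
        (𝓝 (r (⋃ n, g '' K n) + 0)) := by
      refine tendsto_const_nhds.add ?_
      have := (tendsto_add_atTop_iff_nat 1).2 ENNReal.tendsto_inv_nat_nhds_zero
      simpa using this
    rw [add_zero] at hlim
    exact ge_of_tendsto' hlim fun n => tsub_le_iff_right.1
      ((hKr n).trans (measure_mono (subset_iUnion (fun n => g '' K n) n)))
  have hnull : r (range g \ ⋃ n, g '' K n) = 0 := by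
    rw [measure_sdiff hAsub hA.nullMeasurableSet (measure_ne_top _ _)]
    exact tsub_eq_zero_of_le hle
  filter_upwards [measure_eq_zero_iff_ae_notMem.1 hnull] with w hw
  rintro ⟨F, a, ha⟩
  have hwA : w ∈ ⋃ n, g '' K n := by
    by_contra h
    exact hw ⟨⟨a, congrArg Prod.fst ha⟩, h⟩
  obtain ⟨n, hn⟩ := mem_iUnion.1 hwA
  obtain ⟨k, -, hk, hsk⟩ := (hsp w).1 n ⟨σ n w, Prod.ext (hσg n w hn) rfl⟩
  rw [hsk]
  exact hk

/-- Almost everywhere `ε`-optimal measurable selection. -/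
theorem exists_measurable_ae_le_add {W M : Type*} [MeasurableSpace W]
    [StandardBorelSpace W] [MeasurableSpace M] [StandardBorelSpace M] [Nonempty M]
    (r : Measure W) [IsFiniteMeasure r] {S : Set (W × M)} (hS : MeasurableSet S)
    (hne : ∀ w, ∃ F, (w, F) ∈ S) {C : W × M → ℝ≥0∞} (hC : Measurable C)
    {ε : NNReal} (hε : 0 < ε) :
    ∃ s : W → M, Measurable s ∧
      ∀ᵐ w ∂r, (w, s w) ∈ S ∧ ∀ F, (w, F) ∈ S → C (w, s w) ≤ C (w, F) + ε := by
  -- Taking the first level `n` whose selector succeeds costs at most one step `ε`; the selector `d`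
  -- of `S` covers points with no finite-cost choice.
  let B : ℕ → Set (W × M) := fun n => S ∩ {x | C x ≤ n * ε}
  have hB : ∀ n, MeasurableSet (B n) := fun n => hS.inter (hC measurableSet_Iic)
  choose s hs hsB using fun n => exists_measurable_ae_uniformization r (hB n)
  obtain ⟨d, hd, hdS⟩ := exists_measurable_ae_uniformization r hS
  obtain ⟨s', hs', hsp⟩ := exists_measurable_patch hs (p := fun n => {w | (w, s n w) ∈ B n})
    (fun n => (measurable_id.prodMk (hs n)) (hB n)) hd
  refine ⟨s', hs', ?_⟩
  filter_upwards [ae_all_iff.2 hsB, hdS] with w hw hwd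
  refine ⟨?_, fun F hF => ?_⟩
  · by_cases h : ∃ n, (w, s n w) ∈ B n
    · obtain ⟨n, hn⟩ := h
      obtain ⟨k, -, hk, hsk⟩ := (hsp w).1 n hn
      rw [hsk]
      exact hk.1
    · rw [(hsp w).2 (not_exists.1 h)]
      exact hwd (hne w)
  · by_cases htop : C (w, F) = ∞
    · simp [htop]
    lift C (w, F) to NNReal using htop with c hc
    have h1 : c ≤ ⌈c / ε⌉₊ * ε := (div_le_iff₀ hε).1 (Nat.le_ceil _)
    have h2 : ⌈c / ε⌉₊ * ε ≤ c + ε := by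
      calc (⌈c / ε⌉₊ : NNReal) * ε ≤ (c / ε + 1) * ε := by
            gcongr
            exact (Nat.ceil_lt_add_one zero_le).le
        _ = c + ε := by rw [add_mul, div_mul_cancel₀ _ hε.ne', one_mul]
    have hFB : (w, F) ∈ B ⌈c / ε⌉₊ := by
      refine ⟨hF, ?_⟩
      change C (w, F) ≤ _
      rw [← hc]
      exact_mod_cast h1
    obtain ⟨k, hkn, hk, hsk⟩ := (hsp w).1 _ (hw _ ⟨F, hFB⟩)
    rw [hsk]
    calc C (w, s k w) ≤ k * ε := hk.2
      _ ≤ (⌈c / ε⌉₊ : ℝ≥0∞) * ε := by gcongr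
      _ ≤ c + ε := by exact_mod_cast h2

/-! ### A measurable parametrization of probability measures -/

/-- Ensures that the default value `toRatCDF` assigns to sequences that are not CDFs never replaces
a genuine CDF. -/
lemma isRatStieltjesPoint_cdf (μ : Measure ℝ) :
    IsRatStieltjesPoint (id : (ℚ → ℝ) → ℚ → ℝ) (fun t => cdf μ t) where
  mono := fun _ _ h => monotone_cdf μ (Rat.cast_le.2 h)
  tendsto_atTop_one := (tendsto_cdf_atTop μ).comp (tendsto_ratCast_atTop_iff.2 tendsto_id)
  tendsto_atBot_zero := (tendsto_cdf_atBot μ).comp (tendsto_ratCast_atBot_iff.2 tendsto_id)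
  iInf_rat_gt_eq := fun t => by
    rw [id, ← StieltjesFunction.iInf_rat_gt_eq (cdf μ) t]
    exact Equiv.iInf_congr (Equiv.subtypeEquivRight fun r => by simp) fun _ => rfl

/-- All probability measures on a nonempty standard Borel space are the values of a single
Markov kernel from a Polish space. -/
theorem exists_markovKernel_forall_exists_eq (Z : Type*) [MeasurableSpace Z]
    [StandardBorelSpace Z] [Nonempty Z] :
    ∃ κ : Kernel (ℚ → ℝ) Z, IsMarkovKernel κ ∧
      ∀ ρ : Measure Z, IsProbabilityMeasure ρ → ∃ F, κ F = ρ := by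
  obtain ⟨e, he⟩ := exists_measurableEmbedding_real Z
  obtain ⟨e', he', hee⟩ := he.exists_measurable_extend measurable_id (fun _ => ‹Nonempty Z›)
  let κ₀ : Kernel (ℚ → ℝ) ℝ :=
    ⟨fun F => (stieltjesOfMeasurableRat id measurable_id F).measure,
      measurable_measure_stieltjesOfMeasurableRat measurable_id⟩
  have : IsMarkovKernel κ₀ :=
    ⟨fun F => instIsProbabilityMeasure_stieltjesOfMeasurableRat measurable_id F⟩
  refine ⟨κ₀.map e', Kernel.IsMarkovKernel.map _ he', fun ρ hρ => ?_⟩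
  have : IsProbabilityMeasure (ρ.map e) :=
    Measure.isProbabilityMeasure_map he.measurable.aemeasurable
  refine ⟨fun t => cdf (ρ.map e) t, ?_⟩
  have h : κ₀ (fun t => cdf (ρ.map e) t) = ρ.map e := by
    rw [← measure_cdf (ρ.map e)]
    change (stieltjesOfMeasurableRat id measurable_id _).measure = _
    congr 1
    ext x
    rw [← StieltjesFunction.iInf_rat_gt_eq, ← StieltjesFunction.iInf_rat_gt_eq (cdf (ρ.map e))]
    refine iInf_congr fun t => ?_
    rw [measure_cdf, stieltjesOfMeasurableRat_eq,
      toRatCDF_of_isRatStieltjesPoint (isRatStieltjesPoint_cdf _)]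
    rfl
  rw [Kernel.map_apply _ he', h, Measure.map_map he' he.measurable, hee, Measure.map_id]

/-- The set of points at which two Markov kernels coincide is measurable. -/
lemma measurableSet_kernel_eq {A X : Type*} [MeasurableSpace A] [MeasurableSpace X]
    [MeasurableSpace.CountablyGenerated X] (κ η : Kernel A X) [IsMarkovKernel κ]
    [IsMarkovKernel η] : MeasurableSet {a | κ a = η a} := by
  -- A countable generating algebra is a π-system, so equality of the measures amounts to countably
  -- many measurable conditions.
  let G := generateSetAlgebra (MeasurableSpace.countableGeneratingSet X)
  have hG : MeasurableSpace.generateFrom G = ‹MeasurableSpace X› := by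
    rw [generateFrom_generateSetAlgebra_eq, MeasurableSpace.generateFrom_countableGeneratingSet]
  have hGm : ∀ s ∈ G, MeasurableSet s := fun s hs => by
    rw [← hG]; exact MeasurableSpace.measurableSet_generateFrom hs
  have hcount : G.Countable :=
    countable_generateSetAlgebra MeasurableSpace.countable_countableGeneratingSet
  have : {a | κ a = η a} = ⋂ s ∈ G, {a | κ a s = η a s} := by
    ext a
    simp only [mem_iInter]
    refine ⟨fun h s _ => congrArg (fun μ : Measure X => μ s) h, fun h => ?_⟩
    exact ext_of_generate_finite G hG.symm
      isSetAlgebra_generateSetAlgebra.isSetRing.isSetSemiring.isPiSystem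
      (fun s hs => h s hs) (by simp)
  rw [this]
  exact .biInter hcount fun s hs => measurableSet_eq_fun
    (κ.measurable_coe (hGm s hs)) (η.measurable_coe (hGm s hs))

/-! ### Gluing conditional couplings -/

/-- Identifies the marginals of the glued coupling. The hypothesis is almost everywhere because the
selected couplings are admissible only there. -/
lemma map_compProd_eq_map_swap {W X Y Z : Type*} [MeasurableSpace W] [MeasurableSpace X]
    [MeasurableSpace Y] [MeasurableSpace Z] {r : Measure W} [IsFiniteMeasure r]
    {κ : Kernel W Z} [IsMarkovKernel κ] {P : Kernel Y X} [IsMarkovKernel P]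
    {f : W → Y} {g : Z → X} (hf : Measurable f) (hg : Measurable g)
    (h : ∀ᵐ w ∂r, (κ w).map g = P (f w)) :
    (r ⊗ₘ κ).map (fun t => (g t.2, f t.1)) = ((r.map f) ⊗ₘ P).map Prod.swap := by
  ext s hs
  have hm : Measurable fun t : W × Z => (g t.2, f t.1) := by fun_prop
  rw [Measure.map_apply hm hs, Measure.map_apply measurable_swap hs,
    Measure.compProd_apply (hm hs), Measure.compProd_apply (measurable_swap hs),
    lintegral_map (Kernel.measurable_kernel_prodMk_left (measurable_swap hs)) hf]
  refine lintegral_congr_ae ?_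
  filter_upwards [h] with w hw
  rw [← hw, Measure.map_apply hg (measurable_prodMk_left (measurable_swap hs))]
  rfl

lemma IsConditional.map_swap_compProd {X Y : Type*} [MeasurableSpace X] [MeasurableSpace Y]
    {p : Measure (X × Y)} {P : Kernel Y X} (h : IsConditional p P) :
    (p.snd ⊗ₘ P).map Prod.swap = p := by
  have h' : (p.map Prod.swap).IsCondKernel P := h
  have := h'.disintegrate
  rw [Measure.fst_map_swap] at this
  rw [this, Measure.map_map measurable_swap measurable_swap]
  simp

/-- The optimal transport cost of a measurable cost function is at most its chain rule optimal
transport. -/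
theorem otCost_le_crot_otGround {X Y : Type*} [MeasurableSpace X] [StandardBorelSpace X]
    [MeasurableSpace Y] [StandardBorelSpace Y] {c : X × Y → X × Y → ℝ≥0∞}
    (hc : Measurable fun w : (X × Y) × (X × Y) => c w.1 w.2)
    (p q : Measure (X × Y)) [IsProbabilityMeasure p] [IsProbabilityMeasure q]
    (P Q : Kernel Y X) [IsMarkovKernel P] [IsMarkovKernel Q]
    (hP : IsConditional p P) (hQ : IsConditional q Q) :
    otCost c p q ≤ crot (otGround c) p q P Q := by
  have : Nonempty X := (nonempty_of_isProbabilityMeasure p).map Prod.fst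
  refine le_iInf₂ fun r hr => ?_
  obtain ⟨hrp, hr₁, hr₂⟩ := hr
  obtain ⟨κ, hκ, hκs⟩ := exists_markovKernel_forall_exists_eq (X × X)
  let S : Set ((Y × Y) × (ℚ → ℝ)) :=
    {x | (κ x.2).map Prod.fst = P x.1.1} ∩ {x | (κ x.2).map Prod.snd = Q x.1.2}
  have hS : MeasurableSet S := by
    have : IsMarkovKernel (κ.map Prod.fst) :=
      Kernel.IsMarkovKernel.map _ measurable_fst
    have : IsMarkovKernel (κ.map Prod.snd) :=
      Kernel.IsMarkovKernel.map _ measurable_snd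
    have h₁ := measurableSet_kernel_eq
      ((κ.map Prod.fst).comap (fun x : (Y × Y) × (ℚ → ℝ) => x.2) measurable_snd)
      (P.comap (fun x : (Y × Y) × (ℚ → ℝ) => x.1.1) (by fun_prop))
    have h₂ := measurableSet_kernel_eq
      ((κ.map Prod.snd).comap (fun x : (Y × Y) × (ℚ → ℝ) => x.2) measurable_snd)
      (Q.comap (fun x : (Y × Y) × (ℚ → ℝ) => x.1.2) (by fun_prop))
    simp only [Kernel.comap_apply, Kernel.map_apply _ measurable_fst,
      Kernel.map_apply _ measurable_snd] at h₁ h₂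
    exact h₁.inter h₂
  have hne : ∀ w, ∃ F, (w, F) ∈ S := fun w => by
    -- The independent coupling is always admissible.
    obtain ⟨F, hF⟩ := hκs ((P w.1).prod (Q w.2)) inferInstance
    refine ⟨F, ?_, ?_⟩
    · change (κ F).map Prod.fst = P w.1
      rw [hF, Measure.map_fst_prod]; simp
    · change (κ F).map Prod.snd = Q w.2
      rw [hF, Measure.map_snd_prod]; simp
  let C : (Y × Y) × (ℚ → ℝ) → ℝ≥0∞ := fun x =>
    ∫⁻ z, c (z.1, x.1.1) (z.2, x.1.2) ∂(κ x.2)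
  have hC : Measurable C :=
    Measurable.lintegral_kernel_prod_right
      (κ := κ.comap (fun x : (Y × Y) × (ℚ → ℝ) => x.2) measurable_snd)
      (f := fun x z => c (z.1, x.1.1) (z.2, x.1.2))
      (hc.comp (f := fun u : ((Y × Y) × (ℚ → ℝ)) × (X × X) =>
        ((u.2.1, u.1.1.1), (u.2.2, u.1.1.2))) (by fun_prop))
  refine ENNReal.le_of_forall_pos_le_add fun ε hε _ => ?_
  obtain ⟨s, hs, hsS⟩ := exists_measurable_ae_le_add r hS hne hC hε
  let η : Kernel (Y × Y) (X × X) := κ.comap s hs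
  let Φ : (Y × Y) × (X × X) → (X × Y) × (X × Y) := fun t =>
    ((t.2.1, t.1.1), (t.2.2, t.1.2))
  have hΦ : Measurable Φ := by fun_prop
  have hcoup : (r ⊗ₘ η).map Φ ∈ couplings p q := by
    refine ⟨Measure.isProbabilityMeasure_map hΦ.aemeasurable, ?_, ?_⟩
    · rw [Measure.fst, Measure.map_map measurable_fst hΦ]
      refine (map_compProd_eq_map_swap (P := P) measurable_fst measurable_fst ?_).trans ?_
      · filter_upwards [hsS] with w hw using hw.1.1
      · change (r.fst ⊗ₘ P).map Prod.swap = p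
        rw [hr₁, hP.map_swap_compProd]
    · rw [Measure.snd, Measure.map_map measurable_snd hΦ]
      refine (map_compProd_eq_map_swap (P := Q) measurable_snd measurable_snd ?_).trans ?_
      · filter_upwards [hsS] with w hw using hw.1.2
      · change (r.snd ⊗ₘ Q).map Prod.swap = q
        rw [hr₂, hQ.map_swap_compProd]
  calc otCost c p q ≤ ∫⁻ w, c w.1 w.2 ∂(r ⊗ₘ η).map Φ := iInf₂_le _ hcoup
    _ = ∫⁻ w, C (w, s w) ∂r := by
        rw [lintegral_map hc hΦ, Measure.lintegral_compProd (f := fun t => c (Φ t).1 (Φ t).2) (hc.comp hΦ)]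
        rfl
    _ ≤ ∫⁻ w, (otGround c (w.1, P w.1) (w.2, Q w.2) + ε) ∂r := by
        refine lintegral_mono_ae ?_
        filter_upwards [hsS] with w hw
        rw [otGround, otCost, ENNReal.iInf_add]
        refine le_iInf fun ρ => ?_
        rw [ENNReal.iInf_add]
        refine le_iInf fun hρ => ?_
        -- Every competitor `ρ` has a parameter, so optimality among parameters is optimality among
        -- all couplings.
        obtain ⟨F, rfl⟩ := hκs ρ hρ.1
        exact hw.2 F hρ.2
    _ = ∫⁻ w, otGround c (w.1, P w.1) (w.2, Q w.2) ∂r + ε := by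
        -- Only the constant has to be measurable; `otGround` need not be.
        rw [lintegral_add_right _ measurable_const]
        simp

lemma measurable_pNormCost (m n : ℕ) {s : ℝ≥0∞} (hs : 1 ≤ s) :
    Measurable fun w : ((Fin m → ℝ) × (Fin n → ℝ)) × ((Fin m → ℝ) × (Fin n → ℝ)) =>
      pNormCost m n s w.1 w.2 := by
  have : Fact (1 ≤ s) := ⟨hs⟩
  have h : Continuous fun w : ((Fin m → ℝ) × (Fin n → ℝ)) × ((Fin m → ℝ) × (Fin n → ℝ)) =>
      (Sum.elim (w.1.1 - w.2.1) (w.1.2 - w.2.2) : Fin m ⊕ Fin n → ℝ) :=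
    continuous_pi fun i => by
      rcases i with i | i <;> simp only [Sum.elim_inl, Sum.elim_inr, Pi.sub_apply] <;> fun_prop
  exact (ENNReal.continuous_ofReal.comp
    (continuous_norm.comp ((PiLp.continuous_toLp s _).comp h))).measurable

end CROT

theorem mainTheorem3 :
    -- the cost `‖(x,y) - (x',z)‖_s` on `ℝ^m × ℝ^n`, `1 ≤ s ≤ ∞`
    (∀ (m n : ℕ) (s : ℝ≥0∞), 1 ≤ s →
      ∀ (p q : Measure ((Fin m → ℝ) × (Fin n → ℝ)))
        [IsProbabilityMeasure p] [IsProbabilityMeasure q]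
        (P Q : Kernel (Fin n → ℝ) (Fin m → ℝ)) [IsMarkovKernel P] [IsMarkovKernel Q],
        CROT.IsConditional p P → CROT.IsConditional q Q →
        CROT.otCost (CROT.pNormCost m n s) p q
          ≤ CROT.crot (CROT.otGround (CROT.pNormCost m n s)) p q P Q) ∧
    -- any (measurable) metric on `X × Y` in place of the norm
    (∀ (X : Type*) (Y : Type*) [MeasurableSpace X] [StandardBorelSpace X]
        [MeasurableSpace Y] [StandardBorelSpace Y]
        (d : MetricSpace (X × Y)),
      Measurable (fun w : (X × Y) × (X × Y) => d.dist w.1 w.2) →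
      ∀ (p q : Measure (X × Y)) [IsProbabilityMeasure p] [IsProbabilityMeasure q]
        (P Q : Kernel Y X) [IsMarkovKernel P] [IsMarkovKernel Q],
        CROT.IsConditional p P → CROT.IsConditional q Q →
        CROT.otCost (CROT.metricCost d) p q
          ≤ CROT.crot (CROT.otGround (CROT.metricCost d)) p q P Q) := by
  exact ⟨fun m n s hs p q _ _ P Q _ _ hP hQ =>
      CROT.otCost_le_crot_otGround (CROT.measurable_pNormCost m n hs) p q P Q hP hQ,
    fun X Y _ _ _ _ d hd p q _ _ P Q _ _ hP hQ =>
      CROT.otCost_le_crot_otGround hd.ennreal_ofReal p q P Q hP hQ⟩
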